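/- There are a function $T:\mathbb{N}\to\mathbb{N}$ and a single deterministic distributed algorithm $\mathcal{A}$ in the LOCAL model such that the following holds for every finite simple graph $G=(V,E)$ with $n$ nodes and maximum degree $\Delta$, every constant $c$, every assignment of pairwise distinct identifiers from $\{1,\dots,n^c\}$ to the nodes, and every subset of edges $X\subseteq E$. One can assign to each node $v$ a bit string of exactly $\lceil \deg(v)/2\rceil+1$ bits (depending on $G$, the identifiers and $X$) so that, when each node $v$ gets its bit string as local input, $\mathcal{A}$ recovers $X$ in $T(\Delta)$ communication rounds: after $T(\Delta)$ rounds every node correctly outputs, for each of its incident edges, whether this edge belongs to $X$. Here, in the LOCAL model, each node initially knows its own identifier, its degree, $\Delta$, $n$ and its local input, and distinguishes its incident edges by an arbitrary port numbering $0,\dots,\deg(v)-1$ (on which the bit strings do not depend). In each synchronous round, every node sends a message to each neighbor, receives the messages of its neighbors and updates its state; message size and local computation are unrestricted. -/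

import Mathlib

/-- A deterministic distributed algorithm in the LOCAL model, for nodes with local input in `I` and
local output in `O`. Messages and local computation are unrestricted.

* `init n Δ id d x` is the initial state of a node with identifier `id`, degree `d` and local
  input `x` in an `n`-node graph of maximum degree `Δ`;
* `send s i` is the message that a node in state `s` sends through its `i`-th port;
* `step s m` is the next state of a node in state `s` (of degree `d`) that receives the message
  `m i` through its `i`-th port, for `i < d`;
* `output s` is the local output of a node that stops in state `s`. -/
structure LocalAlgorithm (I O : Type) where
  State : Type
  Msg : Type
  init : (n Δ id d : ℕ) → I → State
  send : State → ℕ → Msg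
  step : State → {d : ℕ} → (Fin d → Msg) → State
  output : State → O

/-- A port numbering: every node `v` numbers its incident edges (equivalently, its neighbours)
by `0, …, deg v - 1`. -/
abbrev PortNumbering {V : Type*} [Fintype V] (G : SimpleGraph V) [DecidableRel G.Adj] :=
  (v : V) → Fin (G.degree v) ≃ G.neighborSet v

/-- Identifiers are pairwise distinct and come from `{1, …, n ^ c}`, with `n` the number of nodes. -/
def IsIdAssignment {V : Type*} [Fintype V] (c : ℕ) (ident : V → ℕ) : Prop :=
  Function.Injective ident ∧ ∀ v, 1 ≤ ident v ∧ ident v ≤ Fintype.card V ^ c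

namespace LocalAlgorithm

variable {I O : Type} (A : LocalAlgorithm I O) {V : Type*} [Fintype V] (G : SimpleGraph V)
  [DecidableRel G.Adj] (ident : V → ℕ) (input : V → I) (port : PortNumbering G)

/-- The state of each node after `t` synchronous communication rounds. In each round node `v`
receives through its port `i` the message that its `i`-th neighbour `u` sends through the port
of `u` that leads to `v`. -/
def stateAfter : ℕ → V → A.State
  | 0, v => A.init (Fintype.card V) G.maxDegree (ident v) (G.degree v) (input v)
  | t + 1, v => A.step (stateAfter t v) fun i : Fin (G.degree v) =>
      A.send (stateAfter t (port v i).1)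
        ((port (port v i).1).symm ⟨v, G.adj_symm (port v i).2⟩ : Fin (G.degree (port v i).1))

/-- The output of each node when the algorithm is run for `t` rounds. -/
def run (t : ℕ) (v : V) : O :=
  A.output (A.stateAfter G ident input port t v)

end LocalAlgorithm

/-- With local inputs `label`, after `t` rounds of `A` every node outputs, for each of its incident
edges (referred to by port), whether that edge belongs to `X`; this has to hold for every port
numbering. -/
def DecompressesIn {V : Type*} [Fintype V] (A : LocalAlgorithm (List Bool) (ℕ → Bool)) (t : ℕ)
    (G : SimpleGraph V) [DecidableRel G.Adj] (ident : V → ℕ) (label : V → List Bool)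
    (X : Set (Sym2 V)) : Prop :=
  ∀ (port : PortNumbering G) (v : V) (i : Fin (G.degree v)),
    A.run G ident label port t v i = true ↔ s(v, (port v i).1) ∈ X

/-! ### Pairing the edges at a node -/

/-- On every finite set of naturals there is an involution with at most one fixed point. -/
theorem exists_involution_subsingleton_fixed (N : Finset ℕ) :
    ∃ f : ℕ → ℕ, Function.Involutive f ∧ (∀ a ∉ N, f a = a) ∧
      ∀ a ∈ N, ∀ b ∈ N, f a = a → f b = b → a = b := by
  induction N using Finset.strongInduction with
  | H N ih =>
    by_cases h : ∃ a ∈ N, ∃ b ∈ N, a ≠ b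
    · obtain ⟨a, ha, b, hb, hab⟩ := h
      have hsub : (N.erase a).erase b ⊂ N :=
        (Finset.erase_subset _ _).trans_ssubset (Finset.erase_ssubset ha)
      obtain ⟨f, hf, hoff, hfix⟩ := ih _ hsub
      have fa : f a = a := hoff a (by simp)
      have fb : f b = b := hoff b (by simp)
      have hne : ∀ x, x ≠ a → f x ≠ a := fun x hx h => hx (by rw [← hf x, h, fa])
      have hne' : ∀ x, x ≠ b → f x ≠ b := fun x hx h => hx (by rw [← hf x, h, fb])
      refine ⟨fun x => if x = a then b else if x = b then a else f x, ?_, ?_, ?_⟩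
      · intro x
        by_cases h1 : x = a
        · simp [h1, hab.symm]
        · by_cases h2 : x = b
          · simp [h2]
          · simp [h1, h2, hne x h1, hne' x h2, hf x]
      · intro x hx
        have h1 : x ≠ a := fun h => hx (h ▸ ha)
        have h2 : x ≠ b := fun h => hx (h ▸ hb)
        simp only [h1, h2, if_false]
        exact hoff x (by simp [hx])
      · have key : ∀ x ∈ N, (if x = a then b else if x = b then a else f x) = x →
            x ∈ (N.erase a).erase b ∧ f x = x := by
          intro x hx h
          by_cases h1 : x = a
          · simp [h1, hab.symm] at h
          · by_cases h2 : x = b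
            · simp [h2, hab.symm, hab] at h
            · simp only [h1, h2, if_false] at h
              exact ⟨by simp [h1, h2, hx], h⟩
        intro x hx y hy h1 h2
        exact hfix x (key x hx h1).1 y (key y hy h2).1 (key x hx h1).2 (key y hy h2).2
    · push Not at h
      exact ⟨id, fun _ => rfl, fun _ _ => rfl, fun a ha b hb _ _ => h a ha b hb⟩

/-- A canonical pairing of the elements of `N` that leaves at most one element unpaired. -/
noncomputable def mate (N : Finset ℕ) : ℕ → ℕ :=
  Classical.choose (exists_involution_subsingleton_fixed N)

theorem mate_mate (N : Finset ℕ) (a : ℕ) : mate N (mate N a) = a :=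
  (Classical.choose_spec (exists_involution_subsingleton_fixed N)).1 a

theorem mate_of_notMem {N : Finset ℕ} {a : ℕ} (h : a ∉ N) : mate N a = a :=
  (Classical.choose_spec (exists_involution_subsingleton_fixed N)).2.1 a h

theorem mate_fixed_unique {N : Finset ℕ} {a b : ℕ} (ha : a ∈ N) (hb : b ∈ N)
    (ha' : mate N a = a) (hb' : mate N b = b) : a = b :=
  (Classical.choose_spec (exists_involution_subsingleton_fixed N)).2.2 a ha b hb ha' hb'

theorem mate_mem {N : Finset ℕ} {a : ℕ} (h : a ∈ N) : mate N a ∈ N := by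
  by_contra h'
  have := mate_of_notMem h'
  rw [mate_mate] at this
  exact h' (this ▸ h)

/-! ### Trails in two copies of the graph -/

/-- A directed edge `(a, b)` between identifiers in one of two copies of the graph. -/
abbrev LayeredDart := ℕ × ℕ × Bool

namespace LayeredDart

/-- The reversed dart, in the same layer. -/
def rev : Equiv.Perm LayeredDart :=
  ⟨fun d => (d.2.1, d.1, d.2.2), fun d => (d.2.1, d.1, d.2.2), fun _ => rfl, fun _ => rfl⟩

/-- The same dart in the other layer. -/
def flip : Equiv.Perm LayeredDart :=
  ⟨fun d => (d.1, d.2.1, !d.2.2), fun d => (d.1, d.2.1, !d.2.2),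
    fun d => by simp, fun d => by simp⟩

/-- The reversed dart in the other layer. -/
def dual : Equiv.Perm LayeredDart := rev * flip

theorem rev_apply (d : LayeredDart) : rev d = (d.2.1, d.1, d.2.2) := rfl

theorem flip_apply (d : LayeredDart) : flip d = (d.1, d.2.1, !d.2.2) := rfl

theorem dual_apply (d : LayeredDart) : dual d = (d.2.1, d.1, !d.2.2) := rfl

theorem rev_rev (d : LayeredDart) : rev (rev d) = d := rfl

theorem dual_dual (d : LayeredDart) : dual (dual d) = d := by simp [dual_apply]

theorem rev_dual (d : LayeredDart) : rev (dual d) = flip d := rfl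

theorem dual_rev (d : LayeredDart) : dual (rev d) = flip d := rfl

theorem flip_dual (d : LayeredDart) : flip (dual d) = rev d := by simp [dual_apply, flip_apply, rev_apply]

/-- The dart that follows `d` when edges are paired up at each node by `mate`; at an unpaired edge
the trail turns back into the other layer. -/
noncomputable def next (nb : ℕ → Finset ℕ) (d : LayeredDart) : LayeredDart :=
  if mate (nb d.2.1) d.1 = d.1 then (d.2.1, d.1, !d.2.2)
  else (d.2.1, mate (nb d.2.1) d.1, d.2.2)

/-- Walking backwards uses the same pairing, since `mate` is an involution; hence `next` is
invertible. -/
theorem rev_next_rev_next (nb : ℕ → Finset ℕ) (d : LayeredDart) :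
    rev (next nb (rev (next nb d))) = d := by
  obtain ⟨a, b, i⟩ := d
  by_cases h : mate (nb b) a = a
  · simp [next, rev_apply, h]
  · have h' : mate (nb b) (mate (nb b) a) ≠ mate (nb b) a := by
      rw [mate_mate]; exact fun h1 => h h1.symm
    simp [next, rev_apply, h, mate_mate, Ne.symm h]

/-- The permutation of all darts that moves every dart one step along its trail. -/
noncomputable def trail (nb : ℕ → Finset ℕ) : Equiv.Perm LayeredDart :=
  ⟨next nb, fun d => rev (next nb (rev d)), rev_next_rev_next nb, fun d => by
    simpa [rev_rev] using congrArg rev (rev_next_rev_next nb (rev d))⟩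

variable (nb : ℕ → Finset ℕ)

theorem trail_apply (d : LayeredDart) : trail nb d = next nb d := rfl

theorem semiconj_rev : SemiconjBy rev (trail nb) (trail nb)⁻¹ := by
  ext1 d
  change rev (next nb d) = rev (next nb (rev (rev d)))
  rw [rev_rev]

theorem commute_flip : Commute flip (trail nb) := by
  ext1 d
  change flip (next nb d) = next nb (flip d)
  obtain ⟨a, b, i⟩ := d
  by_cases h : mate (nb b) a = a <;> simp [next, flip_apply, h]

theorem rev_zpow (z : ℤ) (d : LayeredDart) :
    rev ((trail nb ^ z) d) = (trail nb ^ (-z)) (rev d) := by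
  have := (semiconj_rev nb).zpow_right z
  rw [inv_zpow, ← zpow_neg] at this
  exact DFunLike.congr_fun this.eq d

theorem flip_zpow (z : ℤ) (d : LayeredDart) :
    flip ((trail nb ^ z) d) = (trail nb ^ z) (flip d) :=
  DFunLike.congr_fun ((commute_flip nb).zpow_right z).eq d

theorem dual_zpow (z : ℤ) (d : LayeredDart) :
    dual ((trail nb ^ z) d) = (trail nb ^ (-z)) (dual d) := by
  change rev (flip _) = _
  rw [flip_zpow, rev_zpow]; rfl

/-- `d` is an edge of the graph with neighbourhoods `nb`. -/
def IsEdge (nb : ℕ → Finset ℕ) (d : LayeredDart) : Prop := d.2.1 ∈ nb d.1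

end LayeredDart

/-- The neighbourhoods `nb` are those of a simple graph. -/
structure IsNbhd (nb : ℕ → Finset ℕ) : Prop where
  symm : ∀ {a b}, b ∈ nb a → a ∈ nb b
  irrefl : ∀ a, a ∉ nb a

namespace LayeredDart

variable {nb : ℕ → Finset ℕ}

theorem IsEdge.rev (h : IsNbhd nb) {d : LayeredDart} (hd : IsEdge nb d) : IsEdge nb (rev d) :=
  h.symm hd

theorem IsEdge.flip {d : LayeredDart} (hd : IsEdge nb d) : IsEdge nb (flip d) := hd

theorem IsEdge.dual (h : IsNbhd nb) {d : LayeredDart} (hd : IsEdge nb d) : IsEdge nb (dual d) :=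
  h.symm hd

theorem IsEdge.trail (h : IsNbhd nb) {d : LayeredDart} (hd : IsEdge nb d) :
    IsEdge nb (trail nb d) := by
  obtain ⟨a, b, i⟩ := d
  have hd' : a ∈ nb b := h.symm hd
  rw [trail_apply, next]
  split_ifs
  · exact hd'
  · exact mate_mem hd'

theorem IsEdge.zpow (h : IsNbhd nb) {d : LayeredDart} (hd : IsEdge nb d) (z : ℤ) :
    IsEdge nb ((LayeredDart.trail nb ^ z) d) := by
  have hpow : ∀ (n : ℕ) {d}, IsEdge nb d → IsEdge nb ((LayeredDart.trail nb ^ n) d) := by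
    intro n
    induction n with
    | zero => exact fun hd => hd
    | succ n ih => intro d hd; rw [pow_succ']; exact (ih hd).trail h
  obtain ⟨n, rfl | rfl⟩ := z.eq_nat_or_neg
  · rw [zpow_natCast]; exact hpow n hd
  · rw [← rev_rev d, ← rev_zpow, zpow_natCast]
    exact (hpow n (hd.rev h)).rev h

theorem IsEdge.pow (h : IsNbhd nb) {d : LayeredDart} (hd : IsEdge nb d) (n : ℕ) :
    IsEdge nb ((LayeredDart.trail nb ^ n) d) := by
  simpa using hd.zpow h n

theorem IsEdge.ne (h : IsNbhd nb) {d : LayeredDart} (hd : IsEdge nb d) : d.1 ≠ d.2.1 :=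
  fun h1 => h.irrefl d.1 (by have : d.2.1 ∈ nb d.1 := hd; rwa [← h1] at this)

theorem IsEdge.rev_ne (h : IsNbhd nb) {d : LayeredDart} (hd : IsEdge nb d) :
    LayeredDart.rev d ≠ d := fun h1 => hd.ne h (congrArg Prod.fst h1).symm

theorem trail_ne_rev {d : LayeredDart} :
    LayeredDart.trail nb d ≠ LayeredDart.rev d := by
  obtain ⟨a, b, i⟩ := d
  rw [trail_apply, next]
  split_ifs with h1
  · intro h2; simp [rev_apply] at h2
  · intro h2; simp [rev_apply] at h2; exact h1 h2

/-- No trail traverses an edge in both directions within a layer. -/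
theorem IsEdge.not_sameCycle_rev (h : IsNbhd nb) {d : LayeredDart} (hd : IsEdge nb d) :
    ¬ (LayeredDart.trail nb).SameCycle d (LayeredDart.rev d) := by
  rintro ⟨k, hk⟩
  -- If `k` steps lead from `d` to its reverse, reversal reflects the orbit about `k / 2`. For even
  -- `k` the middle dart is its own reverse; for odd `k` two consecutive darts are reverses of each
  -- other in one layer. Both are impossible.
  have key : ∀ j : ℤ, LayeredDart.rev ((LayeredDart.trail nb ^ j) d)
      = (LayeredDart.trail nb ^ (k - j)) d := by
    intro j
    rw [rev_zpow, ← hk, ← Equiv.Perm.mul_apply, ← zpow_add]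
    congr 2; ring
  obtain ⟨j, rfl | rfl⟩ := k.even_or_odd'
  · refine (hd.zpow h j).rev_ne h ?_
    rw [key]; congr 2; ring
  · refine trail_ne_rev (nb := nb) (d := (LayeredDart.trail nb ^ j) d) ?_
    rw [key, ← Equiv.Perm.mul_apply, ← zpow_one_add]
    congr 2; ring

/-- No trail traverses a dart in both layers. -/
theorem IsEdge.not_sameCycle_flip (h : IsNbhd nb) {d : LayeredDart} (hd : IsEdge nb d) :
    ¬ (LayeredDart.trail nb).SameCycle d (LayeredDart.flip d) := by
  rintro ⟨y, hy⟩
  -- If the trail turns back somewhere, reflection about that turn puts `dual d` on it, and together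
  -- with `flip d` also `rev d`. Otherwise it never changes its layer.
  by_cases hb : ∃ j : ℤ, LayeredDart.trail nb ((LayeredDart.trail nb ^ j) d)
      = LayeredDart.dual ((LayeredDart.trail nb ^ j) d)
  · obtain ⟨j, hj⟩ := hb
    rw [dual_zpow, ← Equiv.Perm.mul_apply, ← zpow_one_add] at hj
    have hdual : LayeredDart.dual d = (LayeredDart.trail nb ^ (j + (1 + j))) d := by
      rw [zpow_add, Equiv.Perm.mul_apply, hj, ← Equiv.Perm.mul_apply, ← zpow_add]
      simp
    refine hd.not_sameCycle_rev h ⟨(j + (1 + j)) + y, ?_⟩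
    rw [zpow_add, Equiv.Perm.mul_apply, hy, ← flip_zpow, ← hdual, flip_dual]
  · push Not at hb
    have hstep : ∀ j : ℤ, (LayeredDart.trail nb ((LayeredDart.trail nb ^ j) d)).2.2
        = ((LayeredDart.trail nb ^ j) d).2.2 := by
      intro j
      have := hb j
      rw [trail_apply, next] at this ⊢
      split_ifs at this ⊢
      · exact absurd rfl this
      · rfl
    have hlayer : ∀ j : ℤ, ((LayeredDart.trail nb ^ j) d).2.2 = d.2.2 := by
      intro j
      induction j using Int.induction_on with
      | zero => rfl
      | succ i ih => rw [add_comm, zpow_one_add, Equiv.Perm.mul_apply, hstep, ih]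
      | pred i ih =>
        rw [← ih, ← hstep, ← Equiv.Perm.mul_apply, ← zpow_one_add]
        congr 3; congr 1; ring
    have := hlayer y
    rw [hy, flip_apply] at this
    simp at this

/-- All darts on the trail of `d`. -/
def orbit (nb : ℕ → Finset ℕ) (d : LayeredDart) : Set LayeredDart :=
  {e | (trail nb).SameCycle d e}

/-- A choice of an element of `s`, depending on the set `s` only. -/
noncomputable def pick {α : Type*} [Nonempty α] (s : Set α) : α := Classical.epsilon (· ∈ s)

theorem pick_pair {α : Type*} [Nonempty α] (a b : α) :
    pick {a, b} = a ∨ pick {a, b} = b := by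
  have : pick {a, b} ∈ ({a, b} : Set α) :=
    Classical.epsilon_spec (p := (· ∈ ({a, b} : Set α))) ⟨a, by simp⟩
  simpa using this

/-- Both copies of an undirected trail are oriented by choosing one of its two directions. -/
def Chosen (nb : ℕ → Finset ℕ) (d : LayeredDart) : Prop :=
  pick {orbit nb d ∪ orbit nb (dual d), orbit nb (rev d) ∪ orbit nb (flip d)}
    = orbit nb d ∪ orbit nb (dual d)

theorem orbit_zpow (z : ℤ) (d : LayeredDart) : orbit nb ((trail nb ^ z) d) = orbit nb d := by
  ext e
  exact Equiv.Perm.sameCycle_zpow_left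

theorem chosen_zpow (z : ℤ) (d : LayeredDart) : Chosen nb ((trail nb ^ z) d) ↔ Chosen nb d := by
  simp only [Chosen, dual_zpow, rev_zpow, flip_zpow, orbit_zpow]

theorem chosen_pow (n : ℕ) (d : LayeredDart) : Chosen nb ((trail nb ^ n) d) ↔ Chosen nb d := by
  simpa using chosen_zpow (nb := nb) n d

/-- Marks will not show the layer. Uniting the orbits of `d` and `dual d` makes the choice the same
for the two darts that `base` identifies. -/
theorem chosen_dual (d : LayeredDart) : Chosen nb (dual d) ↔ Chosen nb d := by
  rw [Chosen, Chosen, dual_dual, rev_dual, flip_dual, Set.union_comm (orbit nb (dual d)),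
    Set.union_comm (orbit nb (flip d))]

/-- The two candidate sets differ because neither `rev d` nor `flip d` lies on the trail of `d`, so
exactly one direction is picked. -/
theorem IsEdge.chosen_rev (h : IsNbhd nb) {d : LayeredDart} (hd : IsEdge nb d) :
    Chosen nb (LayeredDart.rev d) ↔ ¬ Chosen nb d := by
  have hne : orbit nb d ∪ orbit nb (LayeredDart.dual d)
      ≠ orbit nb (LayeredDart.rev d) ∪ orbit nb (LayeredDart.flip d) := by
    intro heq
    have hmem : d ∈ orbit nb d ∪ orbit nb (LayeredDart.dual d) := Or.inl (Equiv.Perm.SameCycle.refl _ _)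
    rw [heq] at hmem
    rcases hmem with hm | hm
    · exact hd.not_sameCycle_rev h hm.symm
    · exact hd.not_sameCycle_flip h hm.symm
  have hflip : LayeredDart.flip (LayeredDart.rev d) = LayeredDart.dual d := rfl
  rw [Chosen, Chosen, dual_rev, rev_rev, hflip, Set.pair_comm]
  rcases pick_pair (orbit nb d ∪ orbit nb (LayeredDart.dual d))
    (orbit nb (LayeredDart.rev d) ∪ orbit nb (LayeredDart.flip d)) with h1 | h1 <;> rw [h1]
  · simp [hne]
  · simp [hne.symm]

/-- The trail that leaves `v` towards `c` has entered `v` from the mate of `c`. -/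
theorem chosen_of_mate (h : IsNbhd nb) {v c : ℕ} (hc : c ∈ nb v) (hm : mate (nb v) c ≠ c)
    (hC : Chosen nb (v, c, false)) : ¬ Chosen nb (v, mate (nb v) c, false) := by
  have hedge : IsEdge nb (mate (nb v) c, v, false) := h.symm (mate_mem hc)
  have := hedge.chosen_rev h
  rw [rev_apply] at this
  rw [this, not_not]
  have hstep : trail nb (mate (nb v) c, v, false) = (v, c, false) := by
    rw [trail_apply, next]
    simp [mate_mate, Ne.symm hm]
  rw [← hstep] at hC
  simpa using (chosen_pow (nb := nb) 1 _).1 (by simpa using hC)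

open Classical in
/-- The orientation given by `Chosen` is almost balanced. -/
theorem two_mul_card_chosen_le (h : IsNbhd nb) (v : ℕ) :
    2 * ((nb v).filter fun c => Chosen nb (v, c, false)).card ≤ (nb v).card + 1 := by
  set out := (nb v).filter fun c => Chosen nb (v, c, false) with hout
  set inn := (nb v).filter fun c => ¬ Chosen nb (v, c, false) with hinn
  have hsum : out.card + inn.card = (nb v).card := Finset.card_filter_add_card_filter_not _
  have hsplit : (out.filter fun c => mate (nb v) c = c).card
      + (out.filter fun c => ¬ mate (nb v) c = c).card = out.card :=
    Finset.card_filter_add_card_filter_not _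
  -- Only one edge can be unpaired; it accounts for the `+ 1`.
  have h1 : (out.filter fun c => mate (nb v) c = c).card ≤ 1 := by
    rw [Finset.card_le_one]
    intro a ha b hb
    simp only [hout, Finset.mem_filter] at ha hb
    exact mate_fixed_unique ha.1.1 hb.1.1 ha.2 hb.2
  have h2 : (out.filter fun c => ¬ mate (nb v) c = c).card ≤ inn.card := by
    refine Finset.card_le_card_of_injOn (mate (nb v)) ?_ ?_
    · intro c hc
      simp only [hout, Finset.coe_filter, Finset.mem_filter, Set.mem_ofPred_eq] at hc
      simp only [hinn, Finset.coe_filter, Set.mem_ofPred_eq]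
      exact ⟨mate_mem hc.1.1, chosen_of_mate h hc.1.1 hc.2 hc.1.2⟩
    · intro a _ b _ hab
      rw [← mate_mate (nb v) a, hab, mate_mate]
  omega

end LayeredDart

/-! ### Conflict-free selection by counting -/

/-- Changing coordinate `w` is a bijection between the fibres of `t w`, so all `L` of them have the
same size. -/
theorem card_filter_indep_coord {ι : Type*} [Fintype ι] [DecidableEq ι] {L : ℕ}
    (P : (ι → Fin L) → Prop) [DecidablePred P] (w : ι)
    (hP : ∀ t k, P (Function.update t w k) ↔ P t) (k : Fin L) :
    L * (Finset.univ.filter fun t : ι → Fin L => t w = k ∧ P t).card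
      = (Finset.univ.filter P).card := by
  have hfib := Finset.card_eq_sum_card_fiberwise (s := Finset.univ.filter P)
    (t := (Finset.univ : Finset (Fin L))) (f := fun t => t w) (fun _ _ => by simp)
  have hconst : ∀ l ∈ (Finset.univ : Finset (Fin L)),
      ((Finset.univ.filter P).filter fun t => t w = l).card
        = (Finset.univ.filter fun t : ι → Fin L => t w = k ∧ P t).card := by
    intro l _
    refine Finset.card_nbij' (fun t => Function.update t w k) (fun t => Function.update t w l)
      ?_ ?_ ?_ ?_
    · intro t ht
      simp at ht ⊢
      exact (hP t k).2 ht.1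
    · intro t ht
      simp at ht ⊢
      exact (hP t l).2 ht.2
    · intro t ht
      simp at ht
      simp [← ht.2]
    · intro t ht
      simp at ht
      simp [← ht.1]
  rw [hfib, Finset.sum_congr rfl hconst]
  simp

/-- If every element conflicts with at most `D` elements of other classes and all classes have
`L ≥ 4 D` elements, then there is a conflict-free choice of one element per class. -/
theorem exists_conflict_free {ι : Type*} [Fintype ι] {L D : ℕ} (hL : 0 < L) (hLD : 4 * D ≤ L)
    (C : ι × Fin L → ι × Fin L → Prop) (hsymm : ∀ x y, C x y → C y x)
    (hC : ∀ x : ι × Fin L, {y : ι × Fin L | C x y ∧ y.1 ≠ x.1}.ncard ≤ D) :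
    ∃ t : ι → Fin L, ∀ i j, i ≠ j → ¬ C (i, t i) (j, t j) := by
  classical
  let good (A : Finset ι) (t : ι → Fin L) : Prop :=
    ∀ i ∈ A, ∀ j ∈ A, i ≠ j → ¬ C (i, t i) (j, t j)
  let N (A : Finset ι) : ℕ := (Finset.univ.filter (good A)).card
  have gmono : ∀ {A B : Finset ι} {t}, A ⊆ B → good B t → good A t :=
    fun hAB h i hi j hj => h i (hAB hi) j (hAB hj)
  have gupd : ∀ (A : Finset ι) (w : ι), w ∉ A → ∀ t k,
      good A (Function.update t w k) ↔ good A t := by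
    intro A w hw t k
    refine forall₂_congr fun i hi => forall₂_congr fun j hj => ?_
    rw [Function.update_of_ne (ne_of_mem_of_not_mem hi hw),
      Function.update_of_ne (ne_of_mem_of_not_mem hj hw)]
  -- A counting substitute for the local lemma: imposing the constraints of one more class loses at
  -- most half of the choices.
  have main : ∀ (n : ℕ) (A : Finset ι) (w : ι), A.card = n → w ∉ A →
      N A ≤ 2 * N (insert w A) := by
    intro n
    induction n using Nat.strong_induction_on with
    | _ n ih =>
      intro A w hA hw
      let K (k : Fin L) : Finset (ι × Fin L) :=
        Finset.univ.filter fun y => C (w, k) y ∧ y.1 ≠ w ∧ y.1 ∈ A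
      have hK : ∀ k, (K k).card ≤ D := by
        intro k
        refine le_trans ?_ (hC (w, k))
        rw [← Set.ncard_coe_finset]
        refine Set.ncard_le_ncard ?_ (Set.toFinite _)
        intro y hy
        simp [K] at hy
        exact ⟨hy.1, hy.2.1⟩
      let bad (k : Fin L) (y : ι × Fin L) : Finset (ι → Fin L) :=
        Finset.univ.filter fun t => t w = k ∧ (t y.1 = y.2 ∧ good (A.erase y.1) t)
      -- Fixing the two conflicting coordinates leaves a fraction `1 / L ^ 2` of the choices good on
      -- `A.erase y.1`; by induction these are at most `2 * N A`.
      have hbad : ∀ k, ∀ y ∈ K k, L * (L * (bad k y).card) ≤ 2 * N A := by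
        intro k y hy
        simp [K] at hy
        have e1 := card_filter_indep_coord
          (fun t : ι → Fin L => t y.1 = y.2 ∧ good (A.erase y.1) t) w (by
            intro t l
            rw [Function.update_of_ne hy.2.1, gupd _ _ (fun h => hw (Finset.mem_of_mem_erase h))]) k
        have e2 := card_filter_indep_coord (good (A.erase y.1)) y.1
          (gupd _ _ (Finset.notMem_erase _ _)) y.2
        have e3 := ih (A.erase y.1).card (by
          rw [← hA]; exact Finset.card_erase_lt_of_mem hy.2.2) (A.erase y.1) y.1 rfl
          (Finset.notMem_erase _ _)
        rw [Finset.insert_erase hy.2.2] at e3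
        calc L * (L * (bad k y).card) = L * _ := by rw [e1]
          _ = N (A.erase y.1) := e2
          _ ≤ _ := e3
      have hcover : Finset.univ.filter (good A) ⊆ Finset.univ.filter (good (insert w A)) ∪
          Finset.univ.biUnion fun k => (K k).biUnion fun y => bad k y := by
        intro t ht
        simp only [Finset.mem_filter, Finset.mem_univ, true_and] at ht
        by_cases hg : good (insert w A) t
        · exact Finset.mem_union_left _ (by simpa using hg)
        · refine Finset.mem_union_right _ ?_
          have : ∃ j ∈ A, C (w, t w) (j, t j) := by
            by_contra hno
            push Not at hno
            refine hg fun i hi j hj hij => ?_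
            rcases Finset.mem_insert.1 hi with rfl | hi'
            · rcases Finset.mem_insert.1 hj with rfl | hj'
              · exact absurd rfl hij
              · exact hno j hj'
            · rcases Finset.mem_insert.1 hj with rfl | hj'
              · exact fun hc => hno i hi' (hsymm _ _ hc)
              · exact ht i hi' j hj' hij
          obtain ⟨j, hj, hc⟩ := this
          simp only [Finset.mem_biUnion, Finset.mem_univ, true_and]
          refine ⟨t w, (j, t j), ?_, ?_⟩
          · simp [K, hc, hj]
            rintro rfl; exact hw hj
          · simp only [bad, Finset.mem_filter, Finset.mem_univ, true_and]
            exact gmono (Finset.erase_subset _ _) ht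
      have hcount : N A ≤ N (insert w A) + ∑ k : Fin L, ∑ y ∈ K k, (bad k y).card :=
        (Finset.card_le_card hcover).trans ((Finset.card_union_le _ _).trans
          (Nat.add_le_add_left (Finset.card_biUnion_le.trans
            (Finset.sum_le_sum fun k _ => Finset.card_biUnion_le)) _))
      have hsum : L * (L * ∑ k : Fin L, ∑ y ∈ K k, (bad k y).card) ≤ L * (D * (2 * N A)) := by
        simp only [Finset.mul_sum]
        calc _ ≤ ∑ k : Fin L, D * (2 * N A) := by
              refine Finset.sum_le_sum fun k _ => ?_
              refine (Finset.sum_le_card_nsmul _ _ _ (hbad k)).trans ?_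
              rw [smul_eq_mul]
              exact Nat.mul_le_mul_right _ (hK k)
          _ = _ := by simp
      have hsum' := Nat.le_of_mul_le_mul_left hsum hL
      set total := ∑ k : Fin L, ∑ y ∈ K k, (bad k y).card
      -- There are at most `L * D` conflicting pairs, so `total` is at most `2 * D * N A / L`, hence
      -- at most `N A / 2`.
      have h4 : L * (2 * total) ≤ L * N A := by nlinarith [Nat.mul_le_mul_right (N A) hLD]
      have h5 := Nat.le_of_mul_le_mul_left h4 hL
      omega
  have hpos : ∀ A : Finset ι, 0 < N A := by
    intro A
    induction A using Finset.induction_on with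
    | empty =>
      refine Finset.card_pos.2 ⟨fun _ => ⟨0, hL⟩, ?_⟩
      simp [good]
    | insert w A hw ih => have := main _ A w rfl hw; omega
  obtain ⟨t, ht⟩ := Finset.card_pos.1 (hpos Finset.univ)
  simp only [Finset.mem_filter] at ht
  exact ⟨t, fun i j hij => ht.2 i (Finset.mem_univ _) j (Finset.mem_univ _) hij⟩

/-! ### Balls and darts near a node -/

/-- The identifiers at distance at most `r` from `a`. -/
def nbBall (nb : ℕ → Finset ℕ) : ℕ → ℕ → Finset ℕ
  | 0, a => {a}
  | r + 1, a => insert a ((nb a).biUnion (nbBall nb r))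

section nbBall

variable {nb : ℕ → Finset ℕ}

theorem mem_nbBall_succ {r a x : ℕ} :
    x ∈ nbBall nb (r + 1) a ↔ x = a ∨ ∃ b ∈ nb a, x ∈ nbBall nb r b := by
  simp [nbBall]

theorem mem_nbBall_self (r a : ℕ) : a ∈ nbBall nb r a := by
  cases r <;> simp [nbBall]

theorem nbBall_trans {r s a x y : ℕ} (hx : x ∈ nbBall nb r a) (hy : y ∈ nbBall nb s x) :
    y ∈ nbBall nb (r + s) a := by
  induction r generalizing a with
  | zero => simp [nbBall] at hx; subst hx; simpa using hy
  | succ r ih =>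
    rcases mem_nbBall_succ.1 hx with rfl | ⟨b, hb, hx'⟩
    · clear ih hx
      induction s generalizing y x r with
      | zero => simp [nbBall] at hy; subst hy; exact mem_nbBall_self _ _
      | succ s ih =>
        rcases mem_nbBall_succ.1 hy with rfl | ⟨b, hb, hy'⟩
        · exact mem_nbBall_self _ _
        · refine mem_nbBall_succ.2 (Or.inr ⟨b, hb, ?_⟩)
          exact ih hy' r
    · rw [show r + 1 + s = r + s + 1 by ring]
      exact mem_nbBall_succ.2 (Or.inr ⟨b, hb, ih hx'⟩)

theorem nbBall_mono {r s a : ℕ} (h : r ≤ s) : nbBall nb r a ⊆ nbBall nb s a := by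
  intro x hx
  obtain ⟨k, rfl⟩ := Nat.exists_eq_add_of_le h
  exact nbBall_trans hx (mem_nbBall_self _ _)

theorem mem_nbBall_one {a b : ℕ} (h : b ∈ nb a) : b ∈ nbBall nb 1 a :=
  mem_nbBall_succ.2 (Or.inr ⟨b, h, by simp [nbBall]⟩)

theorem IsNbhd.mem_nbBall_symm (h : IsNbhd nb) {r a x : ℕ} (hx : x ∈ nbBall nb r a) :
    a ∈ nbBall nb r x := by
  induction r generalizing a with
  | zero => simp [nbBall] at hx ⊢; exact hx.symm
  | succ r ih =>
    rcases mem_nbBall_succ.1 hx with rfl | ⟨b, hb, hx'⟩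
    · exact mem_nbBall_self _ _
    · exact nbBall_trans (ih hx') (mem_nbBall_one (h.symm hb))

theorem card_nbBall_le {Δ : ℕ} (hΔ : ∀ a, (nb a).card ≤ Δ) (r a : ℕ) :
    (nbBall nb r a).card ≤ (Δ + 1) ^ r := by
  induction r generalizing a with
  | zero => simp [nbBall]
  | succ r ih =>
    have h1 : ((nb a).biUnion (nbBall nb r)).card ≤ Δ * (Δ + 1) ^ r :=
      (Finset.card_biUnion_le_card_mul _ _ _ fun b _ => ih b).trans
        (Nat.mul_le_mul_right _ (hΔ a))
    calc (nbBall nb (r + 1) a).card ≤ _ := Finset.card_insert_le _ _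
      _ ≤ Δ * (Δ + 1) ^ r + 1 := Nat.add_le_add_right h1 _
      _ ≤ Δ * (Δ + 1) ^ r + (Δ + 1) ^ r := Nat.add_le_add_left (Nat.one_le_pow _ _ (by omega)) _
      _ = _ := by ring

/-- The darts that start at distance at most `r` from `a`. -/
def dartsNear (nb : ℕ → Finset ℕ) (r a : ℕ) : Finset LayeredDart :=
  (nbBall nb r a).biUnion fun x => {x} ×ˢ (nb x ×ˢ Finset.univ)

theorem mem_dartsNear {r a : ℕ} {d : LayeredDart} :
    d ∈ dartsNear nb r a ↔ d.1 ∈ nbBall nb r a ∧ d.IsEdge nb := by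
  obtain ⟨x, y, i⟩ := d
  simp [dartsNear, LayeredDart.IsEdge]

theorem card_dartsNear_le {Δ : ℕ} (hΔ : ∀ a, (nb a).card ≤ Δ) (r a : ℕ) :
    (dartsNear nb r a).card ≤ 2 * Δ * (Δ + 1) ^ r := by
  refine (Finset.card_biUnion_le_card_mul _ _ (2 * Δ) fun x _ => ?_).trans ?_
  · simp [Finset.card_product, mul_comm]; linarith [hΔ x]
  · rw [mul_comm]; exact Nat.mul_le_mul_left _ (card_nbBall_le hΔ r a)

end nbBall

/-! ### Encoding directed edges by marks -/

/-- `(p, q)` is an edge of two marked nodes; a further marked node nearby tells whether the edge is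
to be read from the larger to the smaller identifier. -/
def IsMark (nb : ℕ → Finset ℕ) (β : Set ℕ) (r p q : ℕ) : Prop :=
  p ∈ β ∧ q ∈ β ∧ q ∈ nb p ∧ (p < q ↔ ¬ ∃ x ∈ nbBall nb r p, x ∈ β ∧ x ≠ p ∧ x ≠ q)

/-- The third mark `x` is adjacent to neither endpoint, so adjacent marked nodes are always the two
ends of an element of `A`. Marks of different elements are more than `r + 1` apart, because `r + (r
+ 1) + r = 3 * r + 1`. -/
theorem exists_isMark_iff {nb : ℕ → Finset ℕ} (h : IsNbhd nb) {r : ℕ} (hr : 1 ≤ r)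
    (A : Set (ℕ × ℕ)) (hA : ∀ w ∈ A, w.2 ∈ nb w.1)
    (hsep : ∀ w ∈ A, ∀ w' ∈ A, w'.1 ∈ nbBall nb (3 * r + 1) w.1 → w = w')
    (hx : ∀ w ∈ A, ∃ x ∈ nbBall nb r w.1, x ∉ nbBall nb 1 w.1 ∧ x ∉ nbBall nb 1 w.2) :
    ∃ β : Set ℕ, ∀ p q, IsMark nb β (r + 1) p q ↔ (p, q) ∈ A := by
  have hx' : ∀ w, ∃ x, w ∈ A →
      x ∈ nbBall nb r w.1 ∧ x ∉ nbBall nb 1 w.1 ∧ x ∉ nbBall nb 1 w.2 := by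
    intro w
    by_cases hw : w ∈ A
    · obtain ⟨x, h1, h2⟩ := hx w hw
      exact ⟨x, fun _ => ⟨h1, h2⟩⟩
    · exact ⟨0, fun h => absurd h hw⟩
  choose x hx using hx'
  let B (w : ℕ × ℕ) : Set ℕ := {y | y = w.1 ∨ y = w.2 ∨ (¬ w.1 < w.2 ∧ y = x w)}
  let β : Set ℕ := {y | ∃ w ∈ A, y ∈ B w}
  have hB : ∀ w ∈ A, ∀ y ∈ B w, y ∈ nbBall nb r w.1 := by
    rintro w hw y (rfl | rfl | ⟨-, rfl⟩)
    · exact mem_nbBall_self _ _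
    · exact nbBall_mono hr (mem_nbBall_one (hA w hw))
    · exact (hx w hw).1
  have hBsep : ∀ w ∈ A, ∀ w' ∈ A, ∀ y ∈ B w, ∀ y' ∈ B w', y' ∈ nbBall nb (r + 1) y → w = w' := by
    intro w hw w' hw' y hy y' hy' hyy
    refine hsep w hw w' hw' ?_
    have := nbBall_trans (nbBall_trans (hB w hw y hy) hyy) (h.mem_nbBall_symm (hB w' hw' y' hy'))
    rwa [show r + (r + 1) + r = 3 * r + 1 by ring] at this
  have hne : ∀ w ∈ A, w.1 ≠ w.2 := fun w hw heq => h.irrefl w.1 (by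
    have := hA w hw; rwa [← heq] at this)
  have hextra : ∀ w ∈ A, ∀ p, p = w.1 ∨ p = w.2 →
      ((∃ y ∈ nbBall nb (r + 1) p, y ∈ β ∧ y ≠ w.1 ∧ y ≠ w.2) ↔ ¬ w.1 < w.2) := by
    intro w hw p hp
    have hpB : p ∈ B w := hp.elim Or.inl fun h => Or.inr (Or.inl h)
    constructor
    · rintro ⟨y, hy, ⟨w', hw', hyB⟩, h1, h2⟩
      obtain rfl := hBsep w hw w' hw' p hpB y hyB hy
      rcases hyB with h3 | h3 | h3
      · exact absurd h3 h1
      · exact absurd h3 h2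
      · exact h3.1
    · intro hlt
      obtain ⟨h1, h2, h3⟩ := hx w hw
      refine ⟨x w, ?_, ⟨w, hw, Or.inr (Or.inr ⟨hlt, rfl⟩)⟩, ?_, ?_⟩
      · have : w.1 ∈ nbBall nb 1 p := by
          rcases hp with rfl | rfl
          · exact mem_nbBall_self _ _
          · exact mem_nbBall_one (h.symm (hA w hw))
        rw [add_comm]
        exact nbBall_trans this h1
      · intro heq; exact h2 (heq ▸ mem_nbBall_self _ _)
      · intro heq; exact h3 (heq ▸ mem_nbBall_self _ _)
  refine ⟨β, fun p q => ⟨?_, fun hw => ?_⟩⟩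
  · rintro ⟨⟨w, hw, hp⟩, ⟨w', hw', hq⟩, hpq, hiff⟩
    obtain rfl := hBsep w hw w' hw' p hp q hq (nbBall_mono (by omega) (mem_nbBall_one hpq))
    obtain ⟨-, hx1, hx2⟩ := hx w hw
    have hqp := h.symm hpq
    rcases hp with rfl | rfl | ⟨-, rfl⟩
    · rcases hq with rfl | rfl | ⟨-, rfl⟩
      · exact absurd hpq (h.irrefl _)
      · exact hw
      · exact absurd (mem_nbBall_one hpq) hx1
    · rcases hq with rfl | rfl | ⟨-, rfl⟩
      -- Read from the wrong end, the third mark is equally visible but the comparison of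
      -- identifiers is reversed.
      · have h1 := hextra w hw w.2 (Or.inr rfl)
        have h2 : (∃ y ∈ nbBall nb (r + 1) w.2, y ∈ β ∧ y ≠ w.2 ∧ y ≠ w.1) ↔
            ∃ y ∈ nbBall nb (r + 1) w.2, y ∈ β ∧ y ≠ w.1 ∧ y ≠ w.2 := by
          simp only [and_comm (a := _ ≠ w.2)]
        rw [h2, h1, not_not] at hiff
        rcases lt_or_gt_of_ne (hne w hw) with hlt | hlt
        · exact absurd (hiff.2 hlt) hlt.asymm
        · exact absurd (hiff.1 hlt) hlt.asymm
      · exact absurd hpq (h.irrefl _)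
      · exact absurd (mem_nbBall_one hpq) hx2
    · rcases hq with rfl | rfl | ⟨-, rfl⟩
      · exact absurd (mem_nbBall_one hqp) hx1
      · exact absurd (mem_nbBall_one hqp) hx2
      · exact absurd hpq (h.irrefl _)
  · refine ⟨⟨_, hw, Or.inl rfl⟩, ⟨_, hw, Or.inr (Or.inl rfl)⟩, hA _ hw, ?_⟩
    rw [hextra _ hw p (Or.inl rfl), not_not]

/-! ### Anchors on long trails -/

/-- The distance at which further marked nodes are placed, for maximum degree `Δ`. -/
def markDist (Δ : ℕ) : ℕ := 2 * Δ * (Δ + 1) ^ 2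

/-- The distance between marked darts, for maximum degree `Δ`. -/
def sepDist (Δ : ℕ) : ℕ := 3 * markDist Δ + 6

/-- The length of trail segments that get a marked dart each, for maximum degree `Δ`. -/
def windowLength (Δ : ℕ) : ℕ := 4 * (2 * Δ * (Δ + 1) ^ sepDist Δ) + markDist Δ + 1

namespace LayeredDart

variable {nb : ℕ → Finset ℕ}

/-- The trail of `d` returns to `d` in fewer than `L` steps. -/
def Short (nb : ℕ → Finset ℕ) (L : ℕ) (d : LayeredDart) : Prop :=
  ∃ k, 0 < k ∧ k < L ∧ (trail nb ^ k) d = d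

theorem short_zpow {L : ℕ} (z : ℤ) (d : LayeredDart) :
    Short nb L ((trail nb ^ z) d) ↔ Short nb L d := by
  refine exists_congr fun k => and_congr_right fun _ => and_congr_right fun _ => ?_
  rw [← zpow_natCast, ← Equiv.Perm.mul_apply, ← zpow_add, add_comm, zpow_add,
    Equiv.Perm.mul_apply, EmbeddingLike.apply_eq_iff_eq]

theorem short_pow {L : ℕ} (k : ℕ) (d : LayeredDart) :
    Short nb L ((trail nb ^ k) d) ↔ Short nb L d := by
  simpa using short_zpow (nb := nb) (L := L) k d

theorem pow_injOn_of_not_short {L : ℕ} {d : LayeredDart} (hd : ¬ Short nb L d) {i j : ℕ}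
    (hi : i < L) (hj : j < L) (hij : (trail nb ^ i) d = (trail nb ^ j) d) : i = j := by
  have key : ∀ {i j : ℕ}, i < j → j < L → (trail nb ^ i) d ≠ (trail nb ^ j) d := by
    intro i j hlt hj heq
    refine hd ⟨j - i, by omega, by omega, ?_⟩
    have : (trail nb ^ i) ((trail nb ^ (j - i)) d) = (trail nb ^ i) d := by
      rw [← Equiv.Perm.mul_apply, ← pow_add, Nat.add_sub_cancel' hlt.le, heq]
    exact (trail nb ^ i).injective this
  rcases lt_trichotomy i j with hlt | heq | hlt
  · exact absurd hij (key hlt hj)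
  · exact heq
  · exact absurd hij.symm (key hlt hi)

theorem IsEdge.fst_pow_mem (h : IsNbhd nb) {d : LayeredDart} (hd : IsEdge nb d) (k : ℕ) :
    ((LayeredDart.trail nb ^ k) d).1 ∈ nbBall nb k d.1 := by
  induction k with
  | zero => exact mem_nbBall_self _ _
  | succ k ih =>
    refine nbBall_trans ih (mem_nbBall_one ?_)
    have h1 : (LayeredDart.trail nb ((LayeredDart.trail nb ^ k) d)).1
        = ((LayeredDart.trail nb ^ k) d).2.1 := by
      rw [trail_apply, next]; split_ifs <;> rfl
    rw [pow_succ', Equiv.Perm.mul_apply, h1]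
    exact hd.pow h k

theorem IsEdge.exists_far (h : IsNbhd nb) {Δ : ℕ} (hΔ : ∀ a, (nb a).card ≤ Δ) {L : ℕ}
    (hL : markDist Δ < L) {d : LayeredDart} (hd : IsEdge nb d) (hs : ¬ Short nb L d) :
    ∃ x ∈ nbBall nb (markDist Δ) d.1, x ∉ nbBall nb 2 d.1 := by
  by_contra hno
  push Not at hno
  -- The first `markDist Δ + 1` darts of a long trail are distinct, more than can start in a ball of
  -- radius 2.
  have hcard : (Finset.range (markDist Δ + 1)).card ≤ (dartsNear nb 2 d.1).card := by
    refine Finset.card_le_card_of_injOn (fun k => (LayeredDart.trail nb ^ k) d) ?_ ?_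
    · intro k hk
      simp only [Finset.coe_range, Set.mem_Iio] at hk
      exact mem_dartsNear.2
        ⟨hno _ (nbBall_mono (by omega) (hd.fst_pow_mem h k)), hd.pow h k⟩
    · intro i hi j hj hij
      simp only [Finset.coe_range, Set.mem_Iio] at hi hj
      exact pow_injOn_of_not_short hs (by omega) (by omega) hij
  have := card_dartsNear_le hΔ 2 d.1
  rw [Finset.card_range] at hcard
  unfold markDist at hcard
  omega

/-- Every long chosen trail can be given well-separated anchors at bounded distances. -/
theorem exists_anchors (h : IsNbhd nb) {Δ : ℕ} (hΔ : ∀ a, (nb a).card ≤ Δ)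
    (hfin : {a | (nb a).Nonempty}.Finite) {R L : ℕ} (hL : 0 < L)
    (hLR : 4 * (2 * Δ * (Δ + 1) ^ R) ≤ L) :
    ∃ E : Set LayeredDart, (∀ e ∈ E, IsEdge nb e ∧ Chosen nb e ∧ ¬ Short nb L e) ∧
      (∀ e ∈ E, ∀ e' ∈ E, e'.1 ∈ nbBall nb R e.1 → e = e') ∧
      ∀ d, IsEdge nb d → Chosen nb d → ¬ Short nb L d →
        ∃ k ≤ 3 * L, (LayeredDart.trail nb ^ k) d ∈ E := by
  classical
  have hEfin : {d : LayeredDart | IsEdge nb d}.Finite := by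
    refine ((hfin.toFinset.biUnion fun x => {x} ×ˢ (nb x ×ˢ Finset.univ)).finite_toSet).subset ?_
    rintro ⟨a, b, i⟩ hd
    simp
    exact ⟨hd, b, hd⟩
  set long := hEfin.toFinset.filter fun d => Chosen nb d ∧ ¬ Short nb L d with hlong
  have mem_long : ∀ d, d ∈ long ↔ IsEdge nb d ∧ Chosen nb d ∧ ¬ Short nb L d := by
    intro d; simp [hlong]
  -- Windows of `L` consecutive darts; by maximality of a disjoint family, every long chosen window
  -- meets one of its members.
  let Disj (F : Finset LayeredDart) : Prop := ∀ W ∈ F, ∀ W' ∈ F, ∀ k < L, ∀ k' < L,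
    (LayeredDart.trail nb ^ k) W = (LayeredDart.trail nb ^ k') W' → W = W'
  obtain ⟨F, hF, hmax⟩ := Finset.exists_max_image (long.powerset.filter Disj) Finset.card
    ⟨∅, by simp [Disj]⟩
  simp only [Finset.mem_filter, Finset.mem_powerset] at hF hmax
  obtain ⟨hFl, hFd⟩ := hF
  have hmeet : ∀ d ∈ long, ∃ W ∈ F, ∃ k < L, ∃ k' < L,
      (LayeredDart.trail nb ^ k) W = (LayeredDart.trail nb ^ k') d := by
    intro d hd
    by_contra hno
    push Not at hno
    have hdF : d ∉ F := fun hdF => hno d hdF 0 hL 0 hL rfl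
    have := hmax (insert d F) ⟨Finset.insert_subset hd hFl, ?_⟩
    · rw [Finset.card_insert_of_notMem hdF] at this
      omega
    · intro W hW W' hW' k hk k' hk' heq
      rcases Finset.mem_insert.1 hW with rfl | hWF
      · rcases Finset.mem_insert.1 hW' with rfl | hWF'
        · rfl
        · exact absurd heq.symm (hno W' hWF' k' hk' k hk)
      · rcases Finset.mem_insert.1 hW' with rfl | hWF'
        · exact absurd heq (hno W hWF k hk k' hk')
        · exact hFd W hWF W' hWF' k hk k' hk' heq
  let C : F × Fin L → F × Fin L → Prop := fun x y =>
    ((LayeredDart.trail nb ^ (y.2 : ℕ)) y.1).1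
      ∈ nbBall nb R ((LayeredDart.trail nb ^ (x.2 : ℕ)) x.1).1
  -- Disjoint windows without repetitions send pairs of window and offset injectively to darts, so
  -- conflicts number at most the darts nearby.
  obtain ⟨t, ht⟩ := exists_conflict_free hL hLR C (fun x y hxy => h.mem_nbBall_symm hxy) (by
    intro x
    refine le_trans ?_ (card_dartsNear_le hΔ R ((LayeredDart.trail nb ^ (x.2 : ℕ)) x.1).1)
    rw [← Set.ncard_coe_finset]
    refine Set.ncard_le_ncard_of_injOn
      (fun y : F × Fin L => (LayeredDart.trail nb ^ (y.2 : ℕ)) (y.1 : LayeredDart)) ?_ ?_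
      (Finset.finite_toSet _)
    · intro y hy
      exact mem_dartsNear.2 ⟨hy.1, ((mem_long _).1 (hFl y.1.2)).1.pow h _⟩
    · rintro ⟨W, k⟩ - ⟨W', k'⟩ - heq
      have hW : W = W' := Subtype.ext (hFd W W.2 W' W'.2 k k.2 k' k'.2 heq)
      subst hW
      exact Prod.ext rfl (Fin.ext
        (pow_injOn_of_not_short ((mem_long _).1 (hFl W.2)).2.2 k.2 k'.2 heq)))
  refine ⟨Set.range fun W : F => (LayeredDart.trail nb ^ (t W : ℕ)) (W : LayeredDart), ?_, ?_, ?_⟩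
  · rintro _ ⟨W, rfl⟩
    obtain ⟨h1, h2, h3⟩ := (mem_long _).1 (hFl W.2)
    exact ⟨h1.pow h _, (chosen_pow _ _).2 h2, fun hs => h3 ((short_pow _ _).1 hs)⟩
  · rintro _ ⟨W, rfl⟩ _ ⟨W', rfl⟩ hnear
    by_contra hne
    exact ht W W' (fun heq => hne (by rw [heq])) hnear
  · intro d h1 h2 h3
    -- Starting `L` steps ahead ensures that the anchor of the window met is not behind `d`.
    obtain ⟨W, hW, k, hk, k', hk', heq⟩ := hmeet ((LayeredDart.trail nb ^ L) d)
      ((mem_long _).2 ⟨h1.pow h _, (chosen_pow _ _).2 h2, fun hs => h3 ((short_pow _ _).1 hs)⟩)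
    have htW := (t ⟨W, hW⟩).2
    refine ⟨L + k' + t ⟨W, hW⟩ - k, by omega, ⟨W, hW⟩, ?_⟩
    apply (LayeredDart.trail nb ^ k).injective
    simp only [← Equiv.Perm.mul_apply, ← pow_add] at heq ⊢
    rw [add_comm k, pow_add, Equiv.Perm.mul_apply, heq, ← Equiv.Perm.mul_apply, ← pow_add]
    congr 2; omega

/-- The edge `d`, directed as its copy in the layer `false` is directed by `Chosen`. -/
def base (d : LayeredDart) : ℕ × ℕ := if d.2.2 then (d.2.1, d.1) else (d.1, d.2.1)

theorem eq_or_eq_dual_of_base_eq {d e : LayeredDart} (h : base d = base e) :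
    d = e ∨ d = dual e := by
  obtain ⟨a, b, i⟩ := d
  obtain ⟨a', b', i'⟩ := e
  cases i <;> cases i' <;> simp_all [base, dual_apply]

/-- One mark per node suffices to recover the orientation of all long trails locally. -/
theorem exists_marks (h : IsNbhd nb) {Δ : ℕ} (hΔ : ∀ a, (nb a).card ≤ Δ)
    (hfin : {a | (nb a).Nonempty}.Finite) :
    ∃ β : Set ℕ, ∀ d, IsEdge nb d → ¬ Short nb (windowLength Δ) d →
      (Chosen nb d ↔ ∃ k ≤ 3 * windowLength Δ, IsMark nb β (markDist Δ + 2)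
        (base ((LayeredDart.trail nb ^ k) d)).1 (base ((LayeredDart.trail nb ^ k) d)).2) := by
  obtain ⟨E, hE, hsep, hcov⟩ := exists_anchors h hΔ hfin (R := sepDist Δ) (L := windowLength Δ)
    (by unfold windowLength; omega) (by unfold windowLength; omega)
  have hends : ∀ e ∈ E, (base e).2 ∈ nb (base e).1 ∧ (base e).1 ∈ nbBall nb 1 e.1 ∧
      (base e).2 ∈ nbBall nb 1 e.1 := by
    intro e he
    have hd : e.2.1 ∈ nb e.1 := (hE e he).1
    unfold base
    split_ifs
    · exact ⟨h.symm hd, mem_nbBall_one hd, mem_nbBall_self _ _⟩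
    · exact ⟨hd, mem_nbBall_self _ _, mem_nbBall_one hd⟩
  obtain ⟨β, hβ⟩ := exists_isMark_iff h (r := markDist Δ + 1) (by omega) (base '' E)
    (by rintro _ ⟨e, he, rfl⟩; exact (hends e he).1)
    (by
      rintro _ ⟨e, he, rfl⟩ _ ⟨e', he', rfl⟩ hnear
      congr 1
      refine hsep e he e' he' ?_
      have := nbBall_trans (nbBall_trans (hends e he).2.1 hnear)
        (h.mem_nbBall_symm (hends e' he').2.1)
      -- `1 + (3 * (markDist Δ + 1) + 1) + 1 = sepDist Δ`.
      exact nbBall_mono (by unfold sepDist; omega) this)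
    (by
      rintro _ ⟨e, he, rfl⟩
      obtain ⟨h1, -, h3⟩ := hE e he
      obtain ⟨x, hx, hx2⟩ := h1.exists_far h hΔ (by unfold windowLength; omega) h3
      obtain ⟨-, hp, hq⟩ := hends e he
      refine ⟨x, ?_, fun hx1 => hx2 (nbBall_trans hp hx1), fun hx1 => hx2 (nbBall_trans hq hx1)⟩
      rw [add_comm]
      exact nbBall_trans (h.mem_nbBall_symm hp) hx)
  refine ⟨β, fun d hd hs => ⟨fun hC => ?_, ?_⟩⟩
  · obtain ⟨k, hk, hkE⟩ := hcov d hd hC hs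
    exact ⟨k, hk, (hβ _ _).2 ⟨_, hkE, rfl⟩⟩
  · rintro ⟨k, -, hk⟩
    obtain ⟨e, he, hbase⟩ := (hβ _ _).1 hk
    obtain ⟨-, hCe, -⟩ := hE e he
    rw [← chosen_pow (nb := nb) k d]
    rcases eq_or_eq_dual_of_base_eq hbase with heq | heq
    · rwa [← heq]
    · rwa [heq, chosen_dual] at hCe

/-! ### Local description of the orientation -/

/-- The first `L` darts on the trail from `d`. -/
def segment (nb : ℕ → Finset ℕ) (L : ℕ) (d : LayeredDart) : Set LayeredDart :=
  {e | ∃ k < L, (trail nb ^ k) d = e}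

theorem segment_eq_orbit {L : ℕ} {d : LayeredDart} (hd : Short nb L d) :
    segment nb L d = orbit nb d := by
  obtain ⟨k, hk0, hkL, hk⟩ := hd
  ext e
  constructor
  · rintro ⟨j, -, rfl⟩
    exact ⟨j, by simp⟩
  · rintro ⟨z, rfl⟩
    have hk' : (k : ℤ) ≠ 0 := by exact_mod_cast hk0.ne'
    have hlt := Int.emod_lt_of_pos z (by exact_mod_cast hk0 : (0 : ℤ) < k)
    have hnn := Int.emod_nonneg z hk'
    refine ⟨(z % k).toNat, by omega, ?_⟩
    have hper : ((trail nb ^ (k : ℤ)) ^ (z / k)) d = d :=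
      Equiv.Perm.zpow_apply_eq_self_of_apply_eq_self (by simpa using hk) _
    have hz : trail nb ^ z = trail nb ^ (z % k) * (trail nb ^ (k : ℤ)) ^ (z / k) := by
      rw [← zpow_mul, ← zpow_add, Int.emod_add_mul_ediv]
    rw [hz, Equiv.Perm.mul_apply, hper, ← zpow_natCast, Int.toNat_of_nonneg hnn]

theorem short_rev {L : ℕ} {d : LayeredDart} (hd : Short nb L d) : Short nb L (rev d) := by
  obtain ⟨k, h1, h2, h3⟩ := hd
  refine ⟨k, h1, h2, ?_⟩
  have := rev_zpow nb (-k) d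
  rw [neg_neg, zpow_natCast] at this
  rw [← this, zpow_neg, zpow_natCast, Equiv.Perm.inv_eq_iff_eq.2 h3.symm]

theorem short_flip {L : ℕ} {d : LayeredDart} (hd : Short nb L d) : Short nb L (flip d) := by
  obtain ⟨k, h1, h2, h3⟩ := hd
  refine ⟨k, h1, h2, ?_⟩
  rw [← zpow_natCast, ← flip_zpow, zpow_natCast, h3]

/-- A description of `Chosen` in terms of a bounded neighbourhood and the marks `β`. -/
def LocallyChosen (nb : ℕ → Finset ℕ) (β : Set ℕ) (Δ : ℕ) (d : LayeredDart) : Prop :=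
  (Short nb (windowLength Δ) d ∧
    pick {segment nb (windowLength Δ) d ∪ segment nb (windowLength Δ) (dual d),
        segment nb (windowLength Δ) (rev d) ∪ segment nb (windowLength Δ) (flip d)}
      = segment nb (windowLength Δ) d ∪ segment nb (windowLength Δ) (dual d)) ∨
  (¬ Short nb (windowLength Δ) d ∧ ∃ k ≤ 3 * windowLength Δ, IsMark nb β (markDist Δ + 2)
        (base ((trail nb ^ k) d)).1 (base ((trail nb ^ k) d)).2)

/-- On a short trail the segments are the full orbits, so `pick` gets the same pair of sets and
makes the same choice. -/
theorem exists_locallyChosen_iff (h : IsNbhd nb) {Δ : ℕ} (hΔ : ∀ a, (nb a).card ≤ Δ)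
    (hfin : {a | (nb a).Nonempty}.Finite) :
    ∃ β : Set ℕ, ∀ d, IsEdge nb d → (LocallyChosen nb β Δ d ↔ Chosen nb d) := by
  obtain ⟨β, hβ⟩ := exists_marks h hΔ hfin
  refine ⟨β, fun d hd => ?_⟩
  by_cases hs : Short nb (windowLength Δ) d
  · simp only [LocallyChosen, hs, true_and, not_true, false_and, or_false, Chosen,
      segment_eq_orbit hs, segment_eq_orbit (short_rev hs), segment_eq_orbit (short_flip hs),
      segment_eq_orbit (d := dual d) (short_rev (short_flip hs))]
  · rw [hβ d hd hs]
    simp [LocallyChosen, hs]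

end LayeredDart

/-! ### Dependence on a bounded ball only -/

variable {nb nb' : ℕ → Finset ℕ}

theorem nbBall_congr {r a : ℕ} (heq : ∀ x ∈ nbBall nb r a, nb x = nb' x) :
    nbBall nb r a = nbBall nb' r a := by
  induction r generalizing a with
  | zero => rfl
  | succ r ih =>
    rw [nbBall, nbBall, ← heq a (mem_nbBall_self _ _)]
    congr 1
    refine Finset.biUnion_congr rfl fun b hb => ih fun x hx => heq x ?_
    exact mem_nbBall_succ.2 (Or.inr ⟨b, hb, hx⟩)

theorem isMark_congr {β β' : Set ℕ} {r p q : ℕ} (hr : 1 ≤ r)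
    (heq : ∀ x ∈ nbBall nb r p, nb x = nb' x ∧ (x ∈ β ↔ x ∈ β')) :
    IsMark nb β r p q ↔ IsMark nb' β' r p q := by
  have hp := heq p (mem_nbBall_self _ _)
  have hex : (∃ x ∈ nbBall nb r p, x ∈ β ∧ x ≠ p ∧ x ≠ q) ↔
      ∃ x ∈ nbBall nb' r p, x ∈ β' ∧ x ≠ p ∧ x ≠ q := by
    rw [← nbBall_congr fun x hx => (heq x hx).1]
    exact exists_congr fun x => and_congr_right fun hx => by rw [(heq x hx).2]
  have hq : q ∈ nb p → (q ∈ β ↔ q ∈ β') := fun hq =>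
    (heq q (nbBall_mono hr (mem_nbBall_one hq))).2
  unfold IsMark
  rw [hex, ← hp.1, hp.2]
  refine and_congr_right fun _ => ⟨?_, ?_⟩
  · rintro ⟨h1, h2, h3⟩
    exact ⟨(hq h2).1 h1, h2, h3⟩
  · rintro ⟨h1, h2, h3⟩
    exact ⟨(hq h2).2 h1, h2, h3⟩

namespace LayeredDart

theorem IsEdge.pow_congr (h : IsNbhd nb) {d : LayeredDart} (hd : IsEdge nb d) {k : ℕ}
    (heq : ∀ x ∈ nbBall nb k d.1, nb x = nb' x) :
    (LayeredDart.trail nb ^ k) d = (LayeredDart.trail nb' ^ k) d := by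
  induction k with
  | zero => rfl
  | succ k ih =>
    have hmem : ((LayeredDart.trail nb ^ k) d).2.1 ∈ nbBall nb (k + 1) d.1 :=
      nbBall_trans (hd.fst_pow_mem h k) (mem_nbBall_one (hd.pow h k))
    rw [pow_succ', pow_succ', Equiv.Perm.mul_apply, Equiv.Perm.mul_apply,
      ← ih fun x hx => heq x (nbBall_mono (Nat.le_succ k) hx), trail_apply, trail_apply, next, next,
      heq _ hmem]

theorem IsEdge.short_congr (h : IsNbhd nb) {d : LayeredDart} (hd : IsEdge nb d) {L : ℕ}
    (heq : ∀ x ∈ nbBall nb L d.1, nb x = nb' x) : Short nb L d ↔ Short nb' L d := by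
  refine exists_congr fun k => and_congr_right fun _ => and_congr_right fun hk => ?_
  rw [hd.pow_congr h fun x hx => heq x (nbBall_mono hk.le hx)]

theorem IsEdge.segment_congr (h : IsNbhd nb) {d : LayeredDart} (hd : IsEdge nb d) {L : ℕ}
    (heq : ∀ x ∈ nbBall nb L d.1, nb x = nb' x) : segment nb L d = segment nb' L d := by
  ext e
  refine exists_congr fun k => and_congr_right fun hk => ?_
  rw [hd.pow_congr h fun x hx => heq x (nbBall_mono hk.le hx)]

/-- The distance on which `LocallyChosen` depends. -/
def orientRadius (Δ : ℕ) : ℕ := 3 * windowLength Δ + markDist Δ + 4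

theorem IsEdge.locallyChosen_congr (h : IsNbhd nb) {β β' : Set ℕ} {Δ : ℕ} {d : LayeredDart}
    (hd : IsEdge nb d)
    (heq : ∀ x ∈ nbBall nb (orientRadius Δ) d.1, nb x = nb' x ∧ (x ∈ β ↔ x ∈ β')) :
    LocallyChosen nb β Δ d ↔ LocallyChosen nb' β' Δ d := by
  have h1 : ∀ x ∈ nbBall nb (windowLength Δ) d.1, nb x = nb' x := fun x hx =>
    (heq x (nbBall_mono (by unfold orientRadius; omega) hx)).1
  have h2 : ∀ x ∈ nbBall nb (windowLength Δ) d.2.1, nb x = nb' x := fun x hx =>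
    (heq x (nbBall_mono (by unfold orientRadius; omega)
      (nbBall_trans (mem_nbBall_one hd) hx))).1
  unfold LocallyChosen
  rw [hd.short_congr h h1, hd.segment_congr h h1,
    (hd.dual h).segment_congr h (nb' := nb') h2, (hd.rev h).segment_congr h (nb' := nb') h2,
    hd.flip.segment_congr h (nb' := nb') h1]
  refine or_congr_right (and_congr_right fun _ => exists_congr fun k => and_congr_right fun hk => ?_)
  rw [← hd.pow_congr h (k := k) fun x hx =>
    (heq x (nbBall_mono (by unfold orientRadius; omega) hx)).1]
  refine isMark_congr (by omega) fun x hx => heq x ?_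
  have hbase : (base ((LayeredDart.trail nb ^ k) d)).1
      ∈ nbBall nb 1 ((LayeredDart.trail nb ^ k) d).1 := by
    unfold base
    split_ifs
    · exact mem_nbBall_one (hd.pow h k)
    · exact mem_nbBall_self _ _
  -- Steps along the trail, one step to the tail of `base`, and the radius of `IsMark` add up.
  refine nbBall_mono ?_ (nbBall_trans (nbBall_trans (hd.fst_pow_mem h k) hbase) hx)
  unfold orientRadius; omega

end LayeredDart

/-! ### Labels and decoding -/

open LayeredDart

open Classical in
/-- The out-neighbours of `v` in the orientation read off from the marks `β`. -/
noncomputable def outNbrs (nb : ℕ → Finset ℕ) (β : Set ℕ) (Δ v : ℕ) : Finset ℕ :=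
  (nb v).filter fun c => LocallyChosen nb β Δ (v, c, false)

theorem outNbrs_congr (h : IsNbhd nb) {β β' : Set ℕ} {Δ v : ℕ}
    (heq : ∀ x ∈ nbBall nb (orientRadius Δ) v, nb x = nb' x ∧ (x ∈ β ↔ x ∈ β')) :
    outNbrs nb β Δ v = outNbrs nb' β' Δ v := by
  classical
  unfold outNbrs
  rw [← (heq v (mem_nbBall_self _ _)).1]
  refine Finset.filter_congr fun c hc => ?_
  exact IsEdge.locallyChosen_congr h (d := (v, c, false)) hc heq

/-- The nodes marked by the first bits of the labels. -/
def markSet (lab : ℕ → List Bool) : Set ℕ := {x | (lab x).headD false = true}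

/-- The bit in the label `l` that belongs to `u`, where the bits after the first one belong to the
elements of `s` in increasing order. -/
def labelBit (l : List Bool) (s : Finset ℕ) (u : ℕ) : Bool :=
  l.getD ((s.filter (· < u)).card + 1) false

/-- The bit of the edge between `v` and `u`, which is part of the label of its tail. -/
noncomputable def decodeEdge (nb : ℕ → Finset ℕ) (lab : ℕ → List Bool) (Δ v u : ℕ) : Bool :=
  if u ∈ outNbrs nb (markSet lab) Δ v then labelBit (lab v) (outNbrs nb (markSet lab) Δ v) u
  else labelBit (lab u) (outNbrs nb (markSet lab) Δ u) v

theorem decodeEdge_congr (h : IsNbhd nb) {lab lab' : ℕ → List Bool} {Δ v u : ℕ} (hu : u ∈ nb v)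
    (heq : ∀ x ∈ nbBall nb (orientRadius Δ + 1) v, nb x = nb' x ∧ lab x = lab' x) :
    decodeEdge nb lab Δ v u = decodeEdge nb' lab' Δ v u := by
  have hmem : ∀ {x}, lab x = lab' x → (x ∈ markSet lab ↔ x ∈ markSet lab') := by
    intro x hx; simp [markSet, hx]
  have hv : outNbrs nb (markSet lab) Δ v = outNbrs nb' (markSet lab') Δ v :=
    outNbrs_congr h fun x hx =>
      have := heq x (nbBall_mono (Nat.le_succ _) hx)
      ⟨this.1, hmem this.2⟩
  have hu' : outNbrs nb (markSet lab) Δ u = outNbrs nb' (markSet lab') Δ u :=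
    outNbrs_congr h fun x hx =>
      have := heq x (mem_nbBall_succ.2 (Or.inr ⟨u, hu, hx⟩))
      ⟨this.1, hmem this.2⟩
  rw [decodeEdge, decodeEdge, hv, hu', (heq v (mem_nbBall_self _ _)).2,
    (heq u (mem_nbBall_succ.2 (Or.inr ⟨u, hu, mem_nbBall_self _ _⟩))).2]

/-- Distinct out-neighbours have distinct ranks, so they do not share a bit. -/
theorem card_filter_lt_injOn (s : Finset ℕ) :
    Set.InjOn (fun u => (s.filter (· < u)).card) s := by
  have key : ∀ a ∈ s, ∀ b, a < b → (s.filter (· < a)).card < (s.filter (· < b)).card := by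
    intro a ha b hab
    refine Finset.card_lt_card ⟨fun x hx => ?_, fun hsub => ?_⟩
    · simp only [Finset.mem_filter] at hx ⊢
      exact ⟨hx.1, hx.2.trans hab⟩
    · have := hsub (show a ∈ s.filter (· < b) by simp [ha, hab])
      simp at this
  intro a ha b hb hab
  rcases lt_trichotomy a b with hlt | heq | hlt
  · exact absurd hab (key a ha b hlt).ne
  · exact heq
  · exact absurd hab (key b hb a hlt).ne'

theorem card_filter_lt_lt {s : Finset ℕ} {u : ℕ} (hu : u ∈ s) :
    (s.filter (· < u)).card < s.card :=
  Finset.card_lt_card (Finset.filter_ssubset.2 ⟨u, hu, lt_irrefl u⟩)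

theorem exists_bits (s : Finset ℕ) {n : ℕ} (hn : s.card ≤ n) (P : ℕ → Prop) :
    ∃ l : List Bool, l.length = n ∧
      ∀ (b : Bool), ∀ u ∈ s, (labelBit (b :: l) s u = true ↔ P u) := by
  classical
  refine ⟨List.ofFn fun j : Fin n => decide (∃ c ∈ s, (s.filter (· < c)).card = j ∧ P c),
    by simp, fun b u hu => ?_⟩
  have hlt := (card_filter_lt_lt hu).trans_le hn
  rw [labelBit, List.getD_cons_succ, List.getD_eq_getElem _ _ (by simpa using hlt)]
  simp only [List.getElem_ofFn, decide_eq_true_eq]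
  constructor
  · rintro ⟨c, hc, heq, hP⟩
    rwa [← card_filter_lt_injOn s hc hu heq]
  · exact fun hP => ⟨u, hu, rfl, hP⟩

/-- Any set of edges can be encoded with `⌈deg / 2⌉ + 1` bits per node. -/
theorem exists_labels (h : IsNbhd nb) {Δ : ℕ} (hΔ : ∀ a, (nb a).card ≤ Δ)
    (hfin : {a | (nb a).Nonempty}.Finite) (E : ℕ → ℕ → Prop) (hE : ∀ a b, E a b ↔ E b a) :
    ∃ lab : ℕ → List Bool, (∀ v, (lab v).length = ⌈((nb v).card : ℚ) / 2⌉₊ + 1) ∧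
      ∀ v, ∀ u ∈ nb v, (decodeEdge nb lab Δ v u = true ↔ E v u) := by
  classical
  obtain ⟨β, hβ⟩ := exists_locallyChosen_iff h hΔ hfin
  have hout : ∀ v, (outNbrs nb β Δ v).card ≤ ⌈((nb v).card : ℚ) / 2⌉₊ := by
    intro v
    have h1 : outNbrs nb β Δ v = (nb v).filter fun c => Chosen nb (v, c, false) :=
      Finset.filter_congr fun c hc => hβ (v, c, false) hc
    have h2 := two_mul_card_chosen_le h v
    rw [← h1] at h2
    have h3 := Nat.le_ceil (((nb v).card : ℚ) / 2)
    have h4 : (nb v).card ≤ 2 * ⌈((nb v).card : ℚ) / 2⌉₊ := by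
      have : ((nb v).card : ℚ) ≤ 2 * (⌈((nb v).card : ℚ) / 2⌉₊ : ℚ) := by linarith
      exact_mod_cast this
    omega
  choose l hl hbit using fun v => exists_bits (outNbrs nb β Δ v) (hout v) (E v)
  have hmark : markSet (fun v => decide (v ∈ β) :: l v) = β := by
    ext x; simp [markSet]
  refine ⟨fun v => decide (v ∈ β) :: l v, fun v => by simp [hl], fun v u hu => ?_⟩
  rw [decodeEdge, hmark]
  split_ifs with hvu
  · exact hbit v _ u hvu
  -- An edge not leaving `v` leaves `u`, by `IsEdge.chosen_rev`.
  · have huv : v ∈ outNbrs nb β Δ u := by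
      refine Finset.mem_filter.2 ⟨h.symm hu, (hβ (u, v, false) (h.symm hu)).2 ?_⟩
      refine (IsEdge.chosen_rev h (d := (v, u, false)) hu).2 fun hC => hvu ?_
      exact Finset.mem_filter.2 ⟨hu, (hβ (v, u, false) hu).2 hC⟩
    rw [hbit u _ v huv, hE]

/-! ### Gathering the neighbourhood -/

/-- A node's identifier, the identifiers of its neighbours, and its label. -/
abbrev NodeRecord := ℕ × Finset ℕ × List Bool

/-- The state of a node that collects the records of all nodes around it. -/
structure GatherState where
  maxDeg : ℕ
  ident : ℕ
  label : List Bool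
  nbrIdent : ℕ → ℕ
  known : Set NodeRecord

/-- The neighbours and the label of the node `x` according to `F`. -/
noncomputable def lookup (F : Set NodeRecord) (x : ℕ) : Finset ℕ × List Bool :=
  Classical.epsilon fun p => (x, p) ∈ F

theorem lookup_eq {F : Set NodeRecord} {w : ℕ → Finset ℕ × List Bool}
    (hF : ∀ f ∈ F, f.2 = w f.1) {x : ℕ} (hx : (x, w x) ∈ F) : lookup F x = w x :=
  hF _ (Classical.epsilon_spec (p := fun p => (x, p) ∈ F) ⟨_, hx⟩)

/-- The algorithm in which all nodes gather their surroundings and then decode their edges. -/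
noncomputable def gatherAlgorithm : LocalAlgorithm (List Bool) (ℕ → Bool) where
  State := GatherState
  Msg := ℕ × Set NodeRecord
  init _ Δ id _ x := ⟨Δ, id, x, fun _ => 0, ∅⟩
  send s _ := (s.ident, s.known)
  step s d m :=
    { s with
      nbrIdent := fun i => if h : i < d then (m ⟨i, h⟩).1 else 0
      known := insert (s.ident, Finset.univ.image fun i => (m i).1, s.label) (⋃ i, (m i).2) }
  output s i := decodeEdge (fun x => (lookup s.known x).1) (fun x => (lookup s.known x).2)
    s.maxDeg s.ident (s.nbrIdent i)

section Gather

variable {V : Type*} [Fintype V] (G : SimpleGraph V) [DecidableRel G.Adj] (ident : V → ℕ)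

/-- The neighbourhoods of `G` in terms of identifiers. -/
def identNbhd (x : ℕ) : Finset ℕ :=
  (Finset.univ.filter fun p : V × V => G.Adj p.1 p.2 ∧ ident p.1 = x).image fun p => ident p.2

variable {G ident}

theorem mem_identNbhd {x y : ℕ} :
    y ∈ identNbhd G ident x ↔ ∃ v u, G.Adj v u ∧ ident v = x ∧ ident u = y := by
  simp [identNbhd, and_assoc]

theorem identNbhd_apply (hinj : Function.Injective ident) (v : V) :
    identNbhd G ident (ident v) = (G.neighborFinset v).image ident := by
  ext y
  simp only [mem_identNbhd, Finset.mem_image, SimpleGraph.mem_neighborFinset]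
  constructor
  · rintro ⟨v', u, hadj, hv, hu⟩
    exact ⟨u, hinj hv ▸ hadj, hu⟩
  · rintro ⟨u, hadj, hu⟩
    exact ⟨v, u, hadj, rfl, hu⟩

theorem card_identNbhd (hinj : Function.Injective ident) (v : V) :
    (identNbhd G ident (ident v)).card = G.degree v := by
  rw [identNbhd_apply hinj, Finset.card_image_of_injective _ hinj, SimpleGraph.card_neighborFinset_eq_degree]

theorem isNbhd_identNbhd (hinj : Function.Injective ident) : IsNbhd (identNbhd G ident) where
  symm := by
    intro a b hb
    obtain ⟨v, u, hadj, hv, hu⟩ := mem_identNbhd.1 hb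
    exact mem_identNbhd.2 ⟨u, v, hadj.symm, hu, hv⟩
  irrefl := by
    intro a ha
    obtain ⟨v, u, hadj, rfl, hu⟩ := mem_identNbhd.1 ha
    exact hadj.ne (hinj hu.symm)

theorem finite_identNbhd : {a | (identNbhd G ident a).Nonempty}.Finite := by
  refine (Set.finite_range ident).subset ?_
  rintro a ⟨b, hb⟩
  obtain ⟨v, u, -, hv, -⟩ := mem_identNbhd.1 hb
  exact ⟨v, hv⟩

theorem card_identNbhd_le (hinj : Function.Injective ident) (a : ℕ) :
    (identNbhd G ident a).card ≤ G.maxDegree := by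
  by_cases ha : ∃ v, ident v = a
  · obtain ⟨v, rfl⟩ := ha
    rw [card_identNbhd hinj]
    exact G.degree_le_maxDegree v
  · have : identNbhd G ident a = ∅ := by
      rw [Finset.eq_empty_iff_forall_notMem]
      intro b hb
      obtain ⟨v, u, -, hv, -⟩ := mem_identNbhd.1 hb
      exact ha ⟨v, hv⟩
    simp [this]

variable (lab : ℕ → List Bool) (port : PortNumbering G)

local notation "gathered" => LocalAlgorithm.stateAfter gatherAlgorithm G ident
  (fun v => lab (ident v)) port

theorem gathered_fixed (t : ℕ) (v : V) :
    GatherState.maxDeg (gathered t v) = G.maxDegree ∧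
      GatherState.ident (gathered t v) = ident v ∧
      GatherState.label (gathered t v) = lab (ident v) := by
  induction t with
  | zero => exact ⟨rfl, rfl, rfl⟩
  | succ t ih => exact ih

theorem gathered_nbrIdent (t : ℕ) (v : V) (i : Fin (G.degree v)) :
    GatherState.nbrIdent (gathered (t + 1) v) i = ident (port v i).1 := by
  have : GatherState.nbrIdent (gathered (t + 1) v) i
      = GatherState.ident (gathered t (port v i).1) := by
    simp [LocalAlgorithm.stateAfter, gatherAlgorithm]
  rw [this, (gathered_fixed lab port t _).2.1]

theorem gathered_known_succ (hinj : Function.Injective ident) (t : ℕ) (v : V) :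
    GatherState.known (gathered (t + 1) v)
      = insert (ident v, identNbhd G ident (ident v), lab (ident v))
        (⋃ i : Fin (G.degree v), GatherState.known (gathered t (port v i).1)) := by
  have h1 : GatherState.known (gathered (t + 1) v)
      = insert (GatherState.ident (gathered t v),
          Finset.univ.image fun i : Fin (G.degree v) =>
            GatherState.ident (gathered t (port v i).1), GatherState.label (gathered t v))
        (⋃ i : Fin (G.degree v), GatherState.known (gathered t (port v i).1)) := rfl
  have h2 : (Finset.univ.image fun i : Fin (G.degree v) =>
      GatherState.ident (gathered t (port v i).1)) = identNbhd G ident (ident v) := by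
    simp only [(gathered_fixed lab port t _).2.1]
    rw [identNbhd_apply hinj]
    ext y
    simp only [Finset.mem_image, Finset.mem_univ, true_and, SimpleGraph.mem_neighborFinset]
    constructor
    · rintro ⟨i, rfl⟩
      exact ⟨_, (port v i).2, rfl⟩
    · rintro ⟨u, hu, rfl⟩
      exact ⟨(port v).symm ⟨u, hu⟩, by simp⟩
  rw [h1, h2, (gathered_fixed lab port t v).2.1, (gathered_fixed lab port t v).2.2]

theorem gathered_known_sound (hinj : Function.Injective ident) (t : ℕ) (v : V) :
    ∀ f ∈ GatherState.known (gathered t v), f.2 = (identNbhd G ident f.1, lab f.1) := by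
  induction t generalizing v with
  | zero => intro f hf; exact absurd hf (Set.notMem_empty f)
  | succ t ih =>
    rw [gathered_known_succ lab port hinj]
    rintro f (rfl | hf)
    · rfl
    · obtain ⟨i, hi⟩ := Set.mem_iUnion.1 hf
      exact ih _ f hi

/-- The extra round is the one in which a node learns its neighbours' identifiers and can form its
own record. -/
theorem gathered_known_complete (hinj : Function.Injective ident) (t : ℕ) (v : V) :
    ∀ x ∈ nbBall (identNbhd G ident) t (ident v),
      (x, identNbhd G ident x, lab x) ∈ GatherState.known (gathered (t + 1) v) := by
  induction t generalizing v with
  | zero =>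
    intro x hx
    rw [gathered_known_succ lab port hinj]
    simp only [nbBall, Finset.mem_singleton] at hx
    subst hx
    exact Or.inl rfl
  | succ t ih =>
    intro x hx
    rw [gathered_known_succ lab port hinj]
    rcases mem_nbBall_succ.1 hx with rfl | ⟨b, hb, hx'⟩
    · exact Or.inl rfl
    · rw [identNbhd_apply hinj, Finset.mem_image] at hb
      obtain ⟨u, hu, rfl⟩ := hb
      rw [SimpleGraph.mem_neighborFinset] at hu
      refine Or.inr (Set.mem_iUnion.2 ⟨(port v).symm ⟨u, hu⟩, ?_⟩)
      rw [Equiv.apply_symm_apply]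
      exact ih u x hx'

theorem run_gatherAlgorithm (hinj : Function.Injective ident) (v : V) (i : Fin (G.degree v)) :
    gatherAlgorithm.run G ident (fun v => lab (ident v)) port (orientRadius G.maxDegree + 2) v i
      = decodeEdge (identNbhd G ident) lab G.maxDegree (ident v) (ident (port v i).1) := by
  have hrun : gatherAlgorithm.run G ident (fun v => lab (ident v)) port
      (orientRadius G.maxDegree + 2) v i
      = decodeEdge
        (fun x => (lookup (GatherState.known (gathered (orientRadius G.maxDegree + 2) v)) x).1)
        (fun x => (lookup (GatherState.known (gathered (orientRadius G.maxDegree + 2) v)) x).2)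
        (GatherState.maxDeg (gathered (orientRadius G.maxDegree + 2) v))
        (GatherState.ident (gathered (orientRadius G.maxDegree + 2) v))
        (GatherState.nbrIdent (gathered (orientRadius G.maxDegree + 2) v) i) := rfl
  rw [hrun, gathered_nbrIdent, (gathered_fixed lab port _ v).1, (gathered_fixed lab port _ v).2.1]
  symm
  refine decodeEdge_congr (isNbhd_identNbhd hinj)
    (mem_identNbhd.2 ⟨v, _, (port v i).2, rfl, rfl⟩) fun x hx => ?_
  have := lookup_eq (w := fun x => (identNbhd G ident x, lab x))
    (gathered_known_sound lab port hinj (orientRadius G.maxDegree + 2) v)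
    (gathered_known_complete lab port hinj (orientRadius G.maxDegree + 1) v x hx)
  rw [this]
  exact ⟨rfl, rfl⟩

end Gather

theorem mainTheorem9 :
    ∃ (T : ℕ → ℕ) (A : LocalAlgorithm (List Bool) (ℕ → Bool)),
      ∀ (V : Type*) [Fintype V] (G : SimpleGraph V) [DecidableRel G.Adj]
        (c : ℕ) (ident : V → ℕ), IsIdAssignment c ident →
        ∀ X : Set (Sym2 V), X ⊆ G.edgeSet →
          ∃ label : V → List Bool,
            (∀ v, (label v).length = ⌈(G.degree v : ℚ) / 2⌉₊ + 1) ∧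
            DecompressesIn A (T G.maxDegree) G ident label X := by
  -- One extra round reaches the ball of the other endpoint, one is spent on learning neighbours'
  -- identifiers.
  refine ⟨fun Δ => orientRadius Δ + 2, gatherAlgorithm, ?_⟩
  intro V _ G _ c ident ⟨hinj, _⟩ X _
  obtain ⟨lab, hlen, hdec⟩ := exists_labels (isNbhd_identNbhd (G := G) hinj)
    (card_identNbhd_le hinj) finite_identNbhd
    (fun a b => ∃ v u, ident v = a ∧ ident u = b ∧ s(v, u) ∈ X) (by
      intro a b
      constructor <;> rintro ⟨v, u, hv, hu, hX⟩ <;> exact ⟨u, v, hu, hv, Sym2.eq_swap ▸ hX⟩)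
  refine ⟨fun v => lab (ident v), fun v => ?_, fun port v i => ?_⟩
  · rw [hlen, card_identNbhd hinj]
  · rw [run_gatherAlgorithm lab port hinj,
      hdec _ _ (mem_identNbhd.2 ⟨v, _, (port v i).2, rfl, rfl⟩)]
    constructor
    · rintro ⟨v', u', hv, hu, hX⟩
      rwa [hinj hv, hinj hu] at hX
    · exact fun hX => ⟨_, _, rfl, rfl, hX⟩
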